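/- For a real square matrix $M$, let $\operatorname{diag}(M)$ be the diagonal matrix with the same diagonal entries as $M$, let $\psi(M)$ (the Metzler part of $M$) be the matrix with $[\psi(M)]_{ii}=M_{ii}$ and $[\psi(M)]_{ij}=|M_{ij}|$ for $i\neq j$, and let $|M|$ be the matrix of the absolute values $|M_{ij}|$. Inequalities $\le$ between matrices are entrywise, $M\prec 0$ means that the symmetric matrix $M$ is negative definite, and $M$ is called Hurwitz if all its complex eigenvalues have negative real parts. Let $A\in\mathbb{R}^{n\times n}$ and $C\in\mathbb{R}^{n_y\times n}$. Then the following statements are equivalent: (e) There exists $L\in\mathbb{R}^{n\times n_y}$ such that $\psi(A-LC)$ is Hurwitz. (f) There exist a diagonal positive definite matrix $P\in\mathbb{R}^{n\times n}$ and matrices $Y\in\mathbb{R}^{n\times n_y}$, $X\in\mathbb{R}^{n\times n}$ such that, with $S=PA-YC$, $$X^\top+X+2\operatorname{diag}(S)\prec 0,\qquad |S-\operatorname{diag}(S)|\le X .$$ Moreover, the gains in (e) are given by $L=P^{-1}Y$: for every triple $(P,Y,X)$ as in (f), the matrix $L=P^{-1}Y$ is such that $\psi(A-LC)$ is Hurwitz;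 and conversely every $L$ for which $\psi(A-LC)$ is Hurwitz is of the form $L=P^{-1}Y$ for some triple $(P,Y,X)$ as in (f). -/

import Mathlib

/-- A real square matrix is Hurwitz if all its (complex) eigenvalues have negative real part. -/
def IsHurwitz {n : ℕ} (M : Matrix (Fin n) (Fin n) ℝ) : Prop :=
  ∀ z : ℂ, Module.End.HasEigenvalue (Matrix.toLin' (M.map Complex.ofReal)) z → z.re < 0

/-- The Metzler part `ψ(M)`: diagonal entries are kept, off-diagonal entries are replaced by their
absolute values. -/
def metzlerPart {n : ℕ} (M : Matrix (Fin n) (Fin n) ℝ) : Matrix (Fin n) (Fin n) ℝ :=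
  Matrix.of fun i j => if i = j then M i j else |M i j|

/-- The diagonal matrix `diag(M)` carrying the diagonal entries of `M`. -/
def diagPart {n : ℕ} (M : Matrix (Fin n) (Fin n) ℝ) : Matrix (Fin n) (Fin n) ℝ :=
  Matrix.diagonal M.diag

/-- `(P, Y, X)` is a solution of the LMI associated with `(A, C)`: `P` is diagonal and positive
definite and, with `S = P A - Y C`, one has `Xᵀ + X + 2 diag(S) ≺ 0` and (entrywise)
`|S - diag(S)| ≤ X`. -/
def IsLMISolution {n p : ℕ} (A : Matrix (Fin n) (Fin n) ℝ) (C : Matrix (Fin p) (Fin n) ℝ)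
    (P : Matrix (Fin n) (Fin n) ℝ) (Y : Matrix (Fin n) (Fin p) ℝ)
    (X : Matrix (Fin n) (Fin n) ℝ) : Prop :=
  P.IsDiag ∧ P.PosDef ∧
    (-(X.transpose + X + (2 : ℝ) • diagPart (P * A - Y * C))).PosDef ∧
    ∀ i j, |((P * A - Y * C) - diagPart (P * A - Y * C)) i j| ≤ X i j

section

open Matrix

variable {n : ℕ}

/-! Put `L = P⁻¹ * Y` and `M = ψ(A - L * C)`. As `P` is a positive diagonal matrix, `P * M = ψ(S) =
|S - diag S| + diag S`, so the LMI makes the form of an entrywise majorant `X + diag S` of `P * M`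
negative definite. Evaluating it at `|x|` bounds the form of `P * M` at `x`, and `P` is a diagonal
Lyapunov matrix for `M` (`isHurwitz_of_diagonal_lyapunov`). Conversely, a Hurwitz Metzler `M` admits
positive `v`, `w` with `M v < 0` and `Mᵀ w < 0` (`exists_pos_mulVec_neg`). Then `P = diag(w i / v
i)` is a Lyapunov matrix (`dotProduct_mulVec_neg_of_metzler`), and `X = |S - diag S|` solves the
LMI. -/

theorem IsHurwitz.det_scalar_sub_ne_zero {M : Matrix (Fin n) (Fin n) ℝ} (h : IsHurwitz M)
    {t : ℝ} (ht : 0 ≤ t) : (t • (1 : Matrix (Fin n) (Fin n) ℝ) - M).det ≠ 0 := by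
  intro hdet
  obtain ⟨v, hv, hv0⟩ := exists_mulVec_eq_zero_iff.mpr hdet
  have hMv : M *ᵥ v = t • v := by
    rw [sub_mulVec, smul_mulVec, one_mulVec, sub_eq_zero] at hv0
    exact hv0.symm
  have hev : Module.End.HasEigenvalue (toLin' (M.map Complex.ofReal)) (t : ℂ) := by
    refine Module.End.hasEigenvalue_of_hasEigenvector (x := fun i => (v i : ℂ)) ⟨?_, ?_⟩
    · rw [Module.End.mem_eigenspace_iff, toLin'_apply]
      ext i
      have := congrArg (fun x : ℝ => (x : ℂ)) (congrFun hMv i)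
      simpa [mulVec, dotProduct] using this
    · contrapose! hv
      ext i
      simpa using congrFun hv i
  have := h t hev
  simp at this
  linarith

/-- A Metzler matrix without nonnegative real eigenvalues has a positive vector which it maps
to a negative one. -/
theorem exists_pos_mulVec_neg {M : Matrix (Fin n) (Fin n) ℝ} (hM : ∀ i j, i ≠ j → 0 ≤ M i j)
    (hdet : ∀ t : ℝ, 0 ≤ t → (t • (1 : Matrix (Fin n) (Fin n) ℝ) - M).det ≠ 0) :
    ∃ v : Fin n → ℝ, (∀ i, 0 < v i) ∧ ∀ i, (M *ᵥ v) i < 0 := by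
  let B : ℝ → Matrix (Fin n) (Fin n) ℝ := fun t => t • 1 - M
  -- By Cramer's rule `f t` solves `(t - M) f = 1`. The set of `t ≥ 0` with `f t ≥ 0` is shown to be
  -- clopen and nonempty, hence contains `0`, and `v = f 0` satisfies `M v = -1`.
  let f : Set.Ici (0 : ℝ) → Fin n → ℝ := fun t => (B t).det⁻¹ • ((B t).adjugate *ᵥ 1)
  have hB : Continuous fun t : Set.Ici (0 : ℝ) => B t := by fun_prop
  have hf : Continuous f :=
    (hB.matrix_det.inv₀ fun t => hdet t t.2).smul (hB.matrix_adjugate.matrix_mulVec continuous_const)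
  have hBf : ∀ (t : Set.Ici (0 : ℝ)) i, (t : ℝ) * f t i - (M *ᵥ f t) i = 1 := by
    intro t i
    have h1 : B t *ᵥ f t = 1 := by
      simp only [f]
      rw [mulVec_smul, mulVec_mulVec, mul_adjugate, smul_mulVec, one_mulVec, smul_smul,
        inv_mul_cancel₀ (hdet t t.2), one_smul]
    have h2 := congrFun h1 i
    simpa only [B, sub_mulVec, smul_mulVec, one_mulVec, Pi.sub_apply, Pi.smul_apply, smul_eq_mul,
      Pi.one_apply] using h2
  -- A vanishing coordinate `i` would turn row `i` of the equation into `-(nonnegative sum) = 1`.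
  -- Thus `f t ≥ 0` is also an open condition.
  have hpos : ∀ t, (∀ i, 0 ≤ f t i) → ∀ i, 0 < f t i := by
    intro t h i
    refine lt_of_le_of_ne (h i) fun h0 => ?_
    have h1 := hBf t i
    have h2 : 0 ≤ ∑ j, M i j * f t j := by
      refine Finset.sum_nonneg fun j _ => ?_
      rcases eq_or_ne i j with rfl | hij
      · simp [← h0]
      · exact mul_nonneg (hM i j hij) (h j)
    change (t : ℝ) * f t i - ∑ j, M i j * f t j = 1 at h1
    rw [← h0] at h1
    linarith
  let T : Set (Set.Ici (0 : ℝ)) := {t | ∀ i, 0 ≤ f t i}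
  have hclosed : IsClosed T := by
    simp only [T, Set.ofPred_forall]
    exact isClosed_iInter fun i => isClosed_le continuous_const ((continuous_apply i).comp hf)
  have hopen : IsOpen T := by
    have : T = {t | ∀ i, 0 < f t i} := by
      ext t
      exact ⟨hpos t, fun h i => (h i).le⟩
    rw [this]
    simp only [Set.ofPred_forall]
    exact isOpen_iInter_of_finite fun i =>
      isOpen_lt continuous_const ((continuous_apply i).comp hf)
  have hne : T.Nonempty := by
    have hs : 0 ≤ ∑ i, ∑ j, |M i j| :=
      Finset.sum_nonneg fun i _ => Finset.sum_nonneg fun j _ => abs_nonneg _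
    -- This `t` dominates every row sum of `M`; at a negative minimal coordinate `i`, row `i` would
    -- give `1 ≤ (t - row sum) * f t i ≤ 0`.
    refine ⟨⟨∑ i, ∑ j, |M i j|, hs⟩, fun k => ?_⟩
    set t : Set.Ici (0 : ℝ) := ⟨∑ i, ∑ j, |M i j|, hs⟩
    obtain ⟨i, -, hi⟩ := Finset.exists_min_image Finset.univ (f t) ⟨k, Finset.mem_univ k⟩
    refine le_trans ?_ (hi k (Finset.mem_univ k))
    by_contra! hneg
    have h1 : (∑ j, M i j) * f t i ≤ (M *ᵥ f t) i := by
      rw [Finset.sum_mul]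
      refine Finset.sum_le_sum fun j _ => ?_
      rcases eq_or_ne i j with rfl | hij
      · exact le_rfl
      · exact mul_le_mul_of_nonneg_left (hi j (Finset.mem_univ j)) (hM i j hij)
    have h2 : ∑ j, M i j ≤ (t : ℝ) :=
      (Finset.sum_le_sum fun j _ => le_abs_self (M i j)).trans
        (Finset.single_le_sum (f := fun i => ∑ j, |M i j|)
          (fun i _ => Finset.sum_nonneg fun j _ => abs_nonneg _) (Finset.mem_univ i))
    have h3 := hBf t i
    nlinarith
  have : PreconnectedSpace (Set.Ici (0 : ℝ)) := Subtype.preconnectedSpace isPreconnected_Ici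
  have hT : T = Set.univ := IsClopen.eq_univ ⟨hclosed, hopen⟩ hne
  have h0 : (⟨0, Set.self_mem_Ici⟩ : Set.Ici (0 : ℝ)) ∈ T := hT ▸ Set.mem_univ _
  refine ⟨f ⟨0, Set.self_mem_Ici⟩, hpos _ h0, fun i => ?_⟩
  have := hBf ⟨0, Set.self_mem_Ici⟩ i
  simp only [zero_mul] at this
  linarith

theorem dotProduct_mulVec_eq_sum (B : Matrix (Fin n) (Fin n) ℝ) (x y : Fin n → ℝ) :
    x ⬝ᵥ B *ᵥ y = ∑ i, ∑ j, B i j * (x i * y j) := by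
  simp only [dotProduct, mulVec, Finset.mul_sum]
  exact Finset.sum_congr rfl fun i _ => Finset.sum_congr rfl fun j _ => by ring

/-- With `x i = v i * y i`, the inequality `2 * y i * y j ≤ y i ^ 2 + y j ^ 2`, weighted by `B i j *
v i * v j`, bounds the form by `∑ i, ((B v) i + (Bᵀ v) i) * v i * y i ^ 2 / 2`. -/
theorem dotProduct_mulVec_neg_of_metzler {B : Matrix (Fin n) (Fin n) ℝ}
    (hB : ∀ i j, i ≠ j → 0 ≤ B i j) {v : Fin n → ℝ} (hv : ∀ i, 0 < v i)
    (hr : ∀ i, (B *ᵥ v) i < 0) (hc : ∀ i, (Bᵀ *ᵥ v) i < 0) {x : Fin n → ℝ} (hx : x ≠ 0) :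
    x ⬝ᵥ B *ᵥ x < 0 := by
  obtain ⟨y, rfl⟩ : ∃ y : Fin n → ℝ, x = fun i => v i * y i :=
    ⟨fun i => x i / v i, by ext i; have := (hv i).ne'; field_simp⟩
  have hle : (fun i => v i * y i) ⬝ᵥ B *ᵥ (fun i => v i * y i) ≤
      ∑ i, ∑ j, (B i j * v j * (v i * y i ^ 2 / 2) + B i j * v i * (v j * y j ^ 2 / 2)) := by
    rw [dotProduct_mulVec_eq_sum]
    refine Finset.sum_le_sum fun i _ => Finset.sum_le_sum fun j _ => ?_
    rcases eq_or_ne i j with rfl | hij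
    · exact le_of_eq (by ring)
    · have := mul_nonneg (mul_nonneg (hB i j hij) (mul_pos (hv i) (hv j)).le)
        (sq_nonneg (y i - y j))
      nlinarith
  have heq : ∑ i, ∑ j, (B i j * v j * (v i * y i ^ 2 / 2) + B i j * v i * (v j * y j ^ 2 / 2)) =
      ∑ i, ((B *ᵥ v) i + (Bᵀ *ᵥ v) i) * (v i * y i ^ 2 / 2) := by
    simp only [Finset.sum_add_distrib, add_mul]
    congr 1
    · simp only [mulVec, dotProduct, Finset.sum_mul]
    · rw [Finset.sum_comm]
      simp only [mulVec, dotProduct, Finset.sum_mul, transpose_apply]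
  refine hle.trans_lt (heq ▸ ?_)
  obtain ⟨k, hk⟩ := Function.ne_iff.mp hx
  have hyk : y k ≠ 0 := fun h => hk (by simp [h])
  refine Finset.sum_neg' (fun i _ => ?_) ⟨k, Finset.mem_univ k, ?_⟩
  · exact mul_nonpos_of_nonpos_of_nonneg (by linarith [hr i, hc i])
      (by have := hv i; positivity)
  · exact mul_neg_of_neg_of_pos (by linarith [hr k, hc k]) (by have := hv k; positivity)

/-- For an eigenvector `a + i b` with eigenvalue `z`, the `Im z` terms cancel when the forms at `a`
and `b` are added, leaving `Re z * ∑ i, d i * (a i ^ 2 + b i ^ 2) < 0`. -/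
theorem isHurwitz_of_diagonal_lyapunov {M : Matrix (Fin n) (Fin n) ℝ} {d : Fin n → ℝ}
    (hd : ∀ i, 0 < d i) (h : ∀ x : Fin n → ℝ, x ≠ 0 → x ⬝ᵥ (diagonal d * M) *ᵥ x < 0) :
    IsHurwitz M := by
  intro z hz
  obtain ⟨w, hw⟩ := hz.exists_hasEigenvector
  have hMw := hw.apply_eq_smul
  have hw0 := hw.2
  let a : Fin n → ℝ := fun i => (w i).re
  let b : Fin n → ℝ := fun i => (w i).im
  have ha : ∀ i, (M *ᵥ a) i = z.re * a i - z.im * b i := fun i => by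
    have := congrArg Complex.re (congrFun hMw i)
    simpa [mulVec, dotProduct, a, b] using this
  have hb : ∀ i, (M *ᵥ b) i = z.re * b i + z.im * a i := fun i => by
    have := congrArg Complex.im (congrFun hMw i)
    simpa [mulVec, dotProduct, a, b] using this
  have hsum : a ⬝ᵥ (diagonal d * M) *ᵥ a + b ⬝ᵥ (diagonal d * M) *ᵥ b =
      z.re * ∑ i, d i * (a i ^ 2 + b i ^ 2) := by
    simp only [← mulVec_mulVec, dotProduct, mulVec_diagonal, ha, hb, Finset.mul_sum,
      ← Finset.sum_add_distrib]
    exact Finset.sum_congr rfl fun i _ => by ring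
  have hle : ∀ x : Fin n → ℝ, x ⬝ᵥ (diagonal d * M) *ᵥ x ≤ 0 := fun x => by
    rcases eq_or_ne x 0 with rfl | hx
    · simp
    · exact (h x hx).le
  have hlt : a ⬝ᵥ (diagonal d * M) *ᵥ a + b ⬝ᵥ (diagonal d * M) *ᵥ b < 0 := by
    by_cases ha0 : a = 0
    · have hb0 : b ≠ 0 := fun hb0 => hw0 <| by
        ext i
        exact Complex.ext (congrFun ha0 i) (congrFun hb0 i)
      linarith [hle a, h b hb0]
    · linarith [hle b, h a ha0]
  have hnn : 0 ≤ ∑ i, d i * (a i ^ 2 + b i ^ 2) :=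
    Finset.sum_nonneg fun i _ => by have := hd i; positivity
  by_contra! hre
  have := mul_nonneg hre hnn
  linarith

theorem metzlerPart_nonneg (M : Matrix (Fin n) (Fin n) ℝ) {i j : Fin n} (hij : i ≠ j) :
    0 ≤ metzlerPart M i j := by
  simp [metzlerPart, hij]

theorem diagonal_mul_metzlerPart {d : Fin n → ℝ} (hd : ∀ i, 0 < d i)
    (M : Matrix (Fin n) (Fin n) ℝ) :
    diagonal d * metzlerPart M = metzlerPart (diagonal d * M) := by
  ext i j
  by_cases hij : i = j <;> simp [metzlerPart, hij, diagonal_mul, abs_mul, abs_of_pos (hd _)]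

theorem metzlerPart_eq_abs_add_diagPart (S : Matrix (Fin n) (Fin n) ℝ) :
    metzlerPart S = (S - diagPart S).map abs + diagPart S := by
  ext i j
  by_cases hij : i = j
  · subst hij; simp [metzlerPart, diagPart]
  · simp [metzlerPart, diagPart, hij]

theorem dotProduct_transpose_add_mulVec (X D : Matrix (Fin n) (Fin n) ℝ) (x : Fin n → ℝ) :
    x ⬝ᵥ (-(Xᵀ + X + (2 : ℝ) • D)) *ᵥ x = -2 * (x ⬝ᵥ (X + D) *ᵥ x) := by
  have : x ⬝ᵥ Xᵀ *ᵥ x = x ⬝ᵥ X *ᵥ x := by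
    rw [mulVec_transpose, dotProduct_comm, dotProduct_mulVec]
  simp only [neg_mulVec, add_mulVec, smul_mulVec, dotProduct_neg, dotProduct_add,
    dotProduct_smul, this, smul_eq_mul]
  ring

theorem IsLMISolution.isHurwitz {p : ℕ} {A : Matrix (Fin n) (Fin n) ℝ}
    {C : Matrix (Fin p) (Fin n) ℝ} {P : Matrix (Fin n) (Fin n) ℝ} {Y : Matrix (Fin n) (Fin p) ℝ}
    {X : Matrix (Fin n) (Fin n) ℝ} (h : IsLMISolution A C P Y X) :
    IsHurwitz (metzlerPart (A - (P⁻¹ * Y) * C)) := by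
  obtain ⟨hP, hPpos, hQ, hX⟩ := h
  have hS : P * (A - P⁻¹ * Y * C) = P * A - Y * C := by
    rw [Matrix.mul_sub, Matrix.mul_assoc, mul_nonsing_inv_cancel_left _ _
      ((isUnit_iff_isUnit_det P).mp hPpos.isUnit)]
  set S := P * A - Y * C
  obtain ⟨d, rfl⟩ : ∃ d, P = diagonal d := ⟨_, hP.diagonal_diag.symm⟩
  have hd : ∀ i, 0 < d i := posDef_diagonal_iff.mp hPpos
  refine isHurwitz_of_diagonal_lyapunov hd fun x hx => ?_
  rw [diagonal_mul_metzlerPart hd, hS, metzlerPart_eq_abs_add_diagPart]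
  have hax : |x| ≠ 0 := by simpa using hx
  have hq := hQ.dotProduct_mulVec_pos hax
  rw [star_trivial, dotProduct_transpose_add_mulVec] at hq
  refine lt_of_le_of_lt ?_ (show |x| ⬝ᵥ (X + diagPart S) *ᵥ |x| < 0 by linarith)
  simp only [dotProduct_mulVec_eq_sum, Matrix.add_apply, map_apply, add_mul, Pi.abs_apply, ← abs_mul]
  refine Finset.sum_le_sum fun i _ => Finset.sum_le_sum fun j _ => add_le_add ?_ (le_of_eq ?_)
  · calc _ ≤ |(S - diagPart S) i j| * |x i * x j| :=
          mul_le_mul_of_nonneg_left (le_abs_self _) (abs_nonneg _)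
      _ ≤ _ := mul_le_mul_of_nonneg_right (hX i j) (abs_nonneg _)
  · by_cases hij : i = j
    · subst hij; simp
    · simp [diagPart, hij]

theorem exists_isLMISolution_of_isHurwitz {p : ℕ} {A : Matrix (Fin n) (Fin n) ℝ}
    {C : Matrix (Fin p) (Fin n) ℝ} {L : Matrix (Fin n) (Fin p) ℝ}
    (h : IsHurwitz (metzlerPart (A - L * C))) :
    ∃ (P : Matrix (Fin n) (Fin n) ℝ) (Y : Matrix (Fin n) (Fin p) ℝ)
      (X : Matrix (Fin n) (Fin n) ℝ), IsLMISolution A C P Y X ∧ L = P⁻¹ * Y := by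
  set M := metzlerPart (A - L * C) with hMdef
  have hM : ∀ i j, i ≠ j → 0 ≤ M i j := fun i j => metzlerPart_nonneg _
  obtain ⟨v, hv, hMv⟩ := exists_pos_mulVec_neg hM fun t ht => h.det_scalar_sub_ne_zero ht
  obtain ⟨w, hw, hMw⟩ := exists_pos_mulVec_neg (M := Mᵀ) (fun i j hij => hM j i hij.symm)
    fun t ht => by
      have := h.det_scalar_sub_ne_zero ht
      rwa [← det_transpose, transpose_sub, transpose_smul, transpose_one] at this
  -- Chosen so that `P v = w`: then `P M v < 0` and `(P M)ᵀ v = Mᵀ w < 0`, so the same `v` serves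
  -- rows and columns.
  let d : Fin n → ℝ := fun i => w i / v i
  have hd : ∀ i, 0 < d i := fun i => div_pos (hw i) (hv i)
  have hP : (diagonal d).PosDef := posDef_diagonal_iff.mpr hd
  have hdv : diagonal d *ᵥ v = w := by
    ext i
    simp [mulVec_diagonal, d, (hv i).ne']
  let S := diagonal d * (A - L * C)
  have hS : diagonal d * A - diagonal d * L * C = S := by
    simp only [S, Matrix.mul_sub, Matrix.mul_assoc]
  refine ⟨diagonal d, diagonal d * L, (S - diagPart S).map abs,
    ⟨isDiag_diagonal d, hP, ?_, fun i j => ?_⟩, ?_⟩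
  · rw [hS]
    refine PosDef.of_dotProduct_mulVec_pos ?_ fun x hx => ?_
    · simp [IsHermitian, conjTranspose_eq_transpose_of_trivial, diagPart, add_comm]
    · rw [star_trivial, dotProduct_transpose_add_mulVec, ← metzlerPart_eq_abs_add_diagPart,
        ← diagonal_mul_metzlerPart hd, ← hMdef]
      have : x ⬝ᵥ (diagonal d * M) *ᵥ x < 0 := by
        refine dotProduct_mulVec_neg_of_metzler (fun i j hij => ?_) hv (fun i => ?_)
          (fun i => ?_) hx
        · rw [diagonal_mul]
          exact mul_nonneg (hd i).le (hM i j hij)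
        · rw [← mulVec_mulVec, mulVec_diagonal]
          exact mul_neg_of_pos_of_neg (hd i) (hMv i)
        · rw [transpose_mul, diagonal_transpose, ← mulVec_mulVec, hdv]
          exact hMw i
      linarith
  · rw [hS, map_apply]
  · rw [nonsing_inv_mul_cancel_left _ _ ((isUnit_iff_isUnit_det _).mp hP.isUnit)]

end

theorem mainTheorem3 {n p : ℕ} (A : Matrix (Fin n) (Fin n) ℝ) (C : Matrix (Fin p) (Fin n) ℝ) :
    ((∃ L : Matrix (Fin n) (Fin p) ℝ, IsHurwitz (metzlerPart (A - L * C))) ↔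
      ∃ (P : Matrix (Fin n) (Fin n) ℝ) (Y : Matrix (Fin n) (Fin p) ℝ)
        (X : Matrix (Fin n) (Fin n) ℝ), IsLMISolution A C P Y X) ∧
    (∀ (P : Matrix (Fin n) (Fin n) ℝ) (Y : Matrix (Fin n) (Fin p) ℝ)
        (X : Matrix (Fin n) (Fin n) ℝ), IsLMISolution A C P Y X →
          IsHurwitz (metzlerPart (A - (P⁻¹ * Y) * C))) ∧
    (∀ L : Matrix (Fin n) (Fin p) ℝ, IsHurwitz (metzlerPart (A - L * C)) →
      ∃ (P : Matrix (Fin n) (Fin n) ℝ) (Y : Matrix (Fin n) (Fin p) ℝ)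
        (X : Matrix (Fin n) (Fin n) ℝ), IsLMISolution A C P Y X ∧ L = P⁻¹ * Y) :=
  ⟨⟨fun ⟨_, hL⟩ =>
      let ⟨P, Y, X, h, _⟩ := exists_isLMISolution_of_isHurwitz hL
      ⟨P, Y, X, h⟩,
    fun ⟨P, Y, _, h⟩ => ⟨P⁻¹ * Y, h.isHurwitz⟩⟩,
    fun _ _ _ h => h.isHurwitz, fun _ hL => exists_isLMISolution_of_isHurwitz hL⟩
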